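/- Let $X$ be a set with at least two points and $\{A_x\}_{x\in X}$ a family of unital C*-algebras; $\otimes$ denotes the completed spatial tensor product. A metric operator field (mof) on $\{A_x\}$ is a family $D=(D_{x,x'})_{x,x'\in X}$ with $D_{x,x'}\in A_x\otimes A_{x'}$ such that (i) there are states $\mu_x$ of $A_x$ with $(\mu_x\otimes\mu_x)(D_{x,x})=0$ for all $x$; (ii) $D_{x,x'}$ is positive and invertible for $x\neq x'$; (iii) $D_{x,x'}$ is the image of $D_{x',x}$ under the flip $A_{x'}\otimes A_x\to A_x\otimes A_{x'}$; (iv) $\mathfrak M D_{x,x''}\le D_{x,x'}\otimes 1_{x''}+1_x\otimes D_{x',x''}$ in $A_x\otimes A_{x'}\otimes A_{x''}$ for all $x,x',x''$, where $\mathfrak M(a\otimes b)=a\otimes 1_{x'}\otimes b$. It is central if $D_{x,x'}\in Z(A_x)\otimes Z(A_{x'})$ for all $x,x'$, and bounded if $\|D\|_\infty:=\sup_{x,x'}\|D_{x,x'}\|<\infty$. For a family $E$ of elements $E_{y,y'}\in B_y\otimes B_{y'}$, positive and invertible for $y\ne y'$, on a family $\{B_y\}_{y\in Y}$ of unital C*-algebras,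 and for an operator field $f$ (that is, $f(y)\in B_y$ for $y\in Y$), put $$\|f\|_E:=\sup_{y\neq y'}\bigl\|E_{y,y'}^{-1/2}\bigl(f(y)\otimes 1_{y'}-1_y\otimes f(y')\bigr)E_{y,y'}^{-1/2}\bigr\|\in[0,\infty].$$ $f$ is Lipschitz with respect to $E$ if $\|f\|_E<\infty$, and $\mathrm{Lip}(E)$ is the set of all bounded Lipschitz operator fields $f$ such that $f(y)\otimes 1_{y'}$ commutes with $E_{y,y'}$ for all $y,y'$. Let $D$ be a central mof on $\{A_x\}$. On the family $\{A_x\otimes A_y\}_{(x,y)\in X\times X}$ let $$(D\times D)_{(x,y),(x',y')}:=D_{x,x'}\otimes 1_y\otimes 1_{y'}+1_x\otimes 1_{x'}\otimes D_{y,y'},$$ regarded as an element of $(A_x\otimes A_y)\otimes(A_{x'}\otimes A_{y'})$ through the canonical isomorphism $A_x\otimes A_{x'}\otimes A_y\otimes A_{y'}\cong(A_x\otimes A_y)\otimes(A_{x'}\otimes A_{y'})$. Then $(D\times D)_{p,q}$ is positive and invertible for all $p\neq q$ in $X\times X$, the operator field $D$ on $\{A_x\otimes A_y\}$ is Lipschitz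 with respect to $D\times D$, and $\|D\|_{D\times D}=1$. Moreover, if $D$ is bounded, then $D\in\mathrm{Lip}(D\times D)$. -/

import Mathlib

universe u v

open scoped TensorProduct ENNReal ComplexOrder
open UniformSpace

noncomputable section

namespace SpatialTensorProduct

section Representations

/-- A unital `*`-representation of a C*-algebra on a Hilbert space. Hilbert spaces in the universe of
`A` suffice: the universal representation, which is faithful, is one of them. -/
structure Rep (A : Type u) [CStarAlgebra A] where
  H : Type u
  [normed : NormedAddCommGroup H]
  [inner : InnerProductSpace ℂ H]
  [complete : CompleteSpace H]
  π : A →⋆ₐ[ℂ] (H →L[ℂ] H)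

attribute [instance] Rep.normed Rep.inner Rep.complete

variable {A B : Type u} [CStarAlgebra A] [CStarAlgebra B]

/-- The Hilbert space tensor product of the spaces of two representations. -/
def HTens (ρ : Rep A) (σ : Rep B) : Type u := Completion (ρ.H ⊗[ℂ] σ.H)

instance (ρ : Rep A) (σ : Rep B) : NormedAddCommGroup (HTens ρ σ) :=
  inferInstanceAs (NormedAddCommGroup (Completion (ρ.H ⊗[ℂ] σ.H)))
instance (ρ : Rep A) (σ : Rep B) : InnerProductSpace ℂ (HTens ρ σ) :=
  inferInstanceAs (InnerProductSpace ℂ (Completion (ρ.H ⊗[ℂ] σ.H)))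
instance (ρ : Rep A) (σ : Rep B) : CompleteSpace (HTens ρ σ) :=
  inferInstanceAs (CompleteSpace (Completion (ρ.H ⊗[ℂ] σ.H)))

/-- The action of `A ⊙ B` on the algebraic tensor product `H ⊙ K` of representation spaces. -/
def preTens (ρ : Rep A) (σ : Rep B) : A ⊗[ℂ] B →ₐ[ℂ] (ρ.H ⊗[ℂ] σ.H →L[ℂ] ρ.H ⊗[ℂ] σ.H) :=
  Algebra.TensorProduct.lift
    { toFun := fun a => TensorProduct.mapL (ρ.π a) 1
      map_one' := by
        rw [map_one]; exact TensorProduct.mapL_id_id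
      map_mul' := fun a b => by
        rw [map_mul, ← TensorProduct.mapL_mul, one_mul]
      map_zero' := by rw [map_zero, TensorProduct.mapL_zero_left]
      map_add' := fun a b => by rw [map_add, TensorProduct.mapL_add_left]
      commutes' := fun r => by
        rw [Algebra.algebraMap_eq_smul_one, Algebra.algebraMap_eq_smul_one, map_smul, map_one,
          TensorProduct.mapL_smul_left]
        congr 1
        exact TensorProduct.mapL_id_id }
    { toFun := fun b => TensorProduct.mapL 1 (σ.π b)
      map_one' := by
        rw [map_one]; exact TensorProduct.mapL_id_id
      map_mul' := fun a b => by
        rw [map_mul, ← TensorProduct.mapL_mul, one_mul]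
      map_zero' := by rw [map_zero, TensorProduct.mapL_zero_right]
      map_add' := fun a b => by rw [map_add, TensorProduct.mapL_add_right]
      commutes' := fun r => by
        rw [Algebra.algebraMap_eq_smul_one, Algebra.algebraMap_eq_smul_one, map_smul, map_one,
          TensorProduct.mapL_smul_right]
        congr 1
        exact TensorProduct.mapL_id_id }
    (fun a b => by
      change TensorProduct.mapL _ _ * TensorProduct.mapL _ _
        = TensorProduct.mapL _ _ * TensorProduct.mapL _ _
      rw [← TensorProduct.mapL_mul, ← TensorProduct.mapL_mul]
      simp only [one_mul, mul_one])

theorem preTens_tmul (ρ : Rep A) (σ : Rep B) (a : A) (b : B) :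
    preTens ρ σ (a ⊗ₜ b) = TensorProduct.mapL (ρ.π a) (σ.π b) := by
  rw [preTens, Algebra.TensorProduct.lift_tmul]
  change TensorProduct.mapL _ _ * TensorProduct.mapL _ _ = _
  rw [← TensorProduct.mapL_mul]
  simp only [one_mul, mul_one]

theorem inner_preTens (ρ : Rep A) (σ : Rep B) (t : A ⊗[ℂ] B) (x y : ρ.H ⊗[ℂ] σ.H) :
    inner ℂ (preTens ρ σ (star t) x) y = inner ℂ x (preTens ρ σ t y) := by
  induction t with
  | zero => simp
  | add s t hs ht => simp [inner_add_left, inner_add_right, hs, ht]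
  | tmul a b =>
    rw [TensorProduct.star_tmul, preTens_tmul, preTens_tmul]
    induction x with
    | zero => simp
    | add x x' hx hx' => simp only [map_add, inner_add_left, hx, hx']
    | tmul p q =>
      induction y with
      | zero => simp
      | add y y' hy hy' => simp only [map_add, inner_add_right, hy, hy']
      | tmul r s =>
        rw [TensorProduct.mapL_tmul, TensorProduct.mapL_tmul, TensorProduct.inner_tmul,
          TensorProduct.inner_tmul, map_star, map_star, ContinuousLinearMap.star_eq_adjoint,
          ContinuousLinearMap.star_eq_adjoint, ContinuousLinearMap.adjoint_inner_left,
          ContinuousLinearMap.adjoint_inner_left]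

/-- The inclusion of the algebraic tensor product `H ⊙ K` in the Hilbert space tensor product. -/
def HTens.incl (ρ : Rep A) (σ : Rep B) : ρ.H ⊗[ℂ] σ.H →ₗᵢ[ℂ] HTens ρ σ :=
  (Completion.toComplₗᵢ : ρ.H ⊗[ℂ] σ.H →ₗᵢ[ℂ] Completion (ρ.H ⊗[ℂ] σ.H))

theorem HTens.dense (ρ : Rep A) (σ : Rep B) : DenseRange (HTens.incl ρ σ) :=
  Completion.denseRange_coe

/-- The extension of a bounded operator from `H ⊙ K` to the Hilbert space tensor product. -/
def HTens.ext {ρ : Rep A} {σ : Rep B} (T : ρ.H ⊗[ℂ] σ.H →L[ℂ] ρ.H ⊗[ℂ] σ.H) :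
    HTens ρ σ →L[ℂ] HTens ρ σ :=
  (T.completion : Completion (ρ.H ⊗[ℂ] σ.H) →L[ℂ] Completion (ρ.H ⊗[ℂ] σ.H))

theorem HTens.ext_incl {ρ : Rep A} {σ : Rep B} (T : ρ.H ⊗[ℂ] σ.H →L[ℂ] ρ.H ⊗[ℂ] σ.H)
    (x : ρ.H ⊗[ℂ] σ.H) : HTens.ext T (HTens.incl ρ σ x) = HTens.incl ρ σ (T x) :=
  ContinuousLinearMap.completion_apply_coe T x

theorem HTens.hom_ext {ρ : Rep A} {σ : Rep B} {S T : HTens ρ σ →L[ℂ] HTens ρ σ}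
    (h : ∀ x, S (HTens.incl ρ σ x) = T (HTens.incl ρ σ x)) : S = T :=
  ContinuousLinearMap.ext fun x => congrFun
    ((HTens.dense ρ σ).equalizer S.continuous T.continuous (funext h)) x

theorem HTens.norm_ext {ρ : Rep A} {σ : Rep B} (T : ρ.H ⊗[ℂ] σ.H →L[ℂ] ρ.H ⊗[ℂ] σ.H) :
    ‖HTens.ext T‖ = ‖T‖ := by
  apply le_antisymm
  · refine ContinuousLinearMap.opNorm_le_bound _ T.opNorm_nonneg fun x => ?_
    induction x using (HTens.dense ρ σ).induction_on with
    | hp => exact isClosed_le (by fun_prop) (by fun_prop)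
    | ih x =>
      rw [HTens.ext_incl, LinearIsometry.norm_map, LinearIsometry.norm_map]
      exact T.le_opNorm x
  · refine ContinuousLinearMap.opNorm_le_bound _ (norm_nonneg (HTens.ext T)) fun x => ?_
    have := (HTens.ext T).le_opNorm (HTens.incl ρ σ x)
    rwa [HTens.ext_incl, LinearIsometry.norm_map, LinearIsometry.norm_map] at this

/-- The representation `π ⊗ σ` of `A ⊙ B` on the Hilbert space tensor product `H ⊗ K`. -/
def tens (ρ : Rep A) (σ : Rep B) : A ⊗[ℂ] B →⋆ₐ[ℂ] (HTens ρ σ →L[ℂ] HTens ρ σ) where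
  toFun t := HTens.ext (preTens ρ σ t)
  map_one' := HTens.hom_ext fun x => by simp [HTens.ext_incl]
  map_mul' s t := HTens.hom_ext fun x => by simp [HTens.ext_incl]
  map_zero' := HTens.hom_ext fun x => by simp [HTens.ext_incl]
  map_add' s t := HTens.hom_ext fun x => by simp [HTens.ext_incl]
  commutes' r := HTens.hom_ext fun x => by simp [HTens.ext_incl, Algebra.algebraMap_eq_smul_one]
  map_star' t := by
    rw [ContinuousLinearMap.star_eq_adjoint, ContinuousLinearMap.eq_adjoint_iff]
    intro x y
    induction x using (HTens.dense ρ σ).induction_on with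
    | hp => exact isClosed_eq (by fun_prop) (by fun_prop)
    | ih x =>
      induction y using (HTens.dense ρ σ).induction_on with
      | hp => exact isClosed_eq (by fun_prop) (by fun_prop)
      | ih y =>
        rw [HTens.ext_incl, HTens.ext_incl, LinearIsometry.inner_map_map,
          LinearIsometry.inner_map_map, inner_preTens]

theorem tens_incl (ρ : Rep A) (σ : Rep B) (t : A ⊗[ℂ] B) (x : ρ.H ⊗[ℂ] σ.H) :
    tens ρ σ t (HTens.incl ρ σ x) = HTens.incl ρ σ (preTens ρ σ t x) :=
  HTens.ext_incl _ _

theorem norm_tens (ρ : Rep A) (σ : Rep B) (t : A ⊗[ℂ] B) : ‖tens ρ σ t‖ = ‖preTens ρ σ t‖ :=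
  HTens.norm_ext _

theorem norm_tens_tmul_le (ρ : Rep A) (σ : Rep B) (a : A) (b : B) :
    ‖tens ρ σ (a ⊗ₜ b)‖ ≤ ‖a‖ * ‖b‖ := by
  rw [norm_tens, preTens_tmul]
  refine (TensorProduct.norm_mapL_le _ _).trans ?_
  gcongr
  · exact NonUnitalStarAlgHom.norm_apply_le ρ.π a
  · exact NonUnitalStarAlgHom.norm_apply_le σ.π b

/-- The spatial (minimal) norm on `A ⊙ B`: the supremum of `‖(π ⊗ σ) t‖` over all representations
`π` of `A` and `σ` of `B`. The supremum is attained at every pair of faithful representations. -/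
def spatialNorm (t : A ⊗[ℂ] B) : ℝ := ⨆ p : Rep A × Rep B, ‖tens p.1 p.2 t‖

theorem bddAbove_tens (t : A ⊗[ℂ] B) :
    BddAbove (Set.range fun p : Rep A × Rep B => ‖tens p.1 p.2 t‖) := by
  induction t with
  | zero => exact ⟨0, by rintro _ ⟨p, rfl⟩; simp⟩
  | tmul a b => exact ⟨‖a‖ * ‖b‖, by rintro _ ⟨p, rfl⟩; exact norm_tens_tmul_le _ _ _ _⟩
  | add s t hs ht =>
    obtain ⟨c, hc⟩ := hs
    obtain ⟨d, hd⟩ := ht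
    refine ⟨c + d, ?_⟩
    rintro _ ⟨p, rfl⟩
    simp only [map_add]
    exact (norm_add_le _ _).trans (add_le_add (hc ⟨p, rfl⟩) (hd ⟨p, rfl⟩))

theorem norm_tens_le (ρ : Rep A) (σ : Rep B) (t : A ⊗[ℂ] B) : ‖tens ρ σ t‖ ≤ spatialNorm t :=
  le_ciSup (bddAbove_tens t) (ρ, σ)

theorem spatialNorm_le {t : A ⊗[ℂ] B} {c : ℝ} (hc : 0 ≤ c)
    (h : ∀ (ρ : Rep A) (σ : Rep B), ‖tens ρ σ t‖ ≤ c) : spatialNorm t ≤ c :=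
  Real.iSup_le (fun p => h p.1 p.2) hc

theorem spatialNorm_nonneg (t : A ⊗[ℂ] B) : 0 ≤ spatialNorm t :=
  Real.iSup_nonneg fun p => norm_nonneg (tens p.1 p.2 t)

theorem spatialNorm_star_mul_self (t : A ⊗[ℂ] B) :
    spatialNorm t * spatialNorm t ≤ spatialNorm (star t * t) := by
  have h : spatialNorm t ≤ √(spatialNorm (star t * t)) := by
    refine spatialNorm_le (Real.sqrt_nonneg _) fun ρ σ => ?_
    apply Real.le_sqrt_of_sq_le
    rw [sq, ← CStarRing.norm_star_mul_self, ← map_star, ← map_mul]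
    exact norm_tens_le _ _ _
  calc _ ≤ √(spatialNorm (star t * t)) * √(spatialNorm (star t * t)) := by
        gcongr; exact spatialNorm_nonneg t
    _ = _ := Real.mul_self_sqrt (spatialNorm_nonneg _)

theorem spatialNorm_star (t : A ⊗[ℂ] B) : spatialNorm (star t) = spatialNorm t := by
  unfold spatialNorm
  simp only [map_star, norm_star]

end Representations

section Algebra

variable (A B : Type u) [CStarAlgebra A] [CStarAlgebra B]

/-- The algebraic tensor product `A ⊙ B`, as a `*`-algebra that carries the spatial norm. -/
def Pre : Type u := A ⊗[ℂ] B

instance : Ring (Pre A B) := inferInstanceAs (Ring (A ⊗[ℂ] B))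
instance : Algebra ℂ (Pre A B) := inferInstanceAs (Algebra ℂ (A ⊗[ℂ] B))
instance : StarRing (Pre A B) := inferInstanceAs (StarRing (A ⊗[ℂ] B))
instance : StarModule ℂ (Pre A B) := inferInstanceAs (StarModule ℂ (A ⊗[ℂ] B))

/-- The spatial norm as a ring seminorm. -/
def spatialSeminorm : RingSeminorm (Pre A B) where
  toFun t := spatialNorm (A := A) (B := B) t
  map_zero' := le_antisymm
    (spatialNorm_le le_rfl fun ρ σ => (congrArg norm (map_zero (tens ρ σ))).trans_le norm_zero.le)
    (spatialNorm_nonneg _)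
  add_le' s t := spatialNorm_le (add_nonneg (spatialNorm_nonneg _) (spatialNorm_nonneg _))
    fun ρ σ => (congrArg norm (map_add (tens ρ σ) s t)).trans_le <|
      (norm_add_le _ _).trans (add_le_add (norm_tens_le _ _ _) (norm_tens_le _ _ _))
  neg' t := congrArg iSup <| funext fun p =>
    (congrArg norm (map_neg (tens p.1 p.2) t)).trans (norm_neg _)
  mul_le' s t := spatialNorm_le (mul_nonneg (spatialNorm_nonneg _) (spatialNorm_nonneg _))
    fun ρ σ => (congrArg norm (map_mul (tens ρ σ) s t)).trans_le <|
      (norm_mul_le _ _).trans (mul_le_mul (norm_tens_le _ _ _) (norm_tens_le _ _ _)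
        (norm_nonneg _) (spatialNorm_nonneg _))

instance : SeminormedRing (Pre A B) :=
  { (spatialSeminorm A B).toSeminormedRing with
    toRing := inferInstance }

variable {A B}

theorem norm_def (t : Pre A B) : ‖t‖ = spatialNorm (A := A) (B := B) t := rfl

instance : NormedAlgebra ℂ (Pre A B) where
  norm_smul_le r t := spatialNorm_le (mul_nonneg (norm_nonneg _) (spatialNorm_nonneg _))
    fun ρ σ => (congrArg norm (map_smul (tens ρ σ) r t)).trans_le <|
      (norm_smul_le _ _).trans (mul_le_mul_of_nonneg_left (norm_tens_le _ _ _) (norm_nonneg _))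

theorem norm_star_pre (t : Pre A B) : ‖star t‖ = ‖t‖ := spatialNorm_star _

end Algebra

section Closed

variable {T : Type*} [NormedRing T]

theorem closed_smul_mul [NormedSpace ℂ T] (r : ℂ) :
    IsClosed {q : T × T | r • q.1 * q.2 = r • (q.1 * q.2)} :=
  isClosed_eq (by fun_prop) (by fun_prop)

theorem closed_mul_smul [NormedSpace ℂ T] (r : ℂ) :
    IsClosed {q : T × T | q.1 * r • q.2 = r • (q.1 * q.2)} :=
  isClosed_eq (by fun_prop) (by fun_prop)

theorem closed_star_mul [Star T] [ContinuousStar T] :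
    IsClosed {q : T × T | star (q.1 * q.2) = star q.2 * star q.1} :=
  isClosed_eq (by fun_prop) (by fun_prop)

theorem closed_star_smul [NormedSpace ℂ T] [Star T] [ContinuousStar T] (r : ℂ) :
    IsClosed {x : T | star (r • x) = star r • star x} :=
  isClosed_eq (by fun_prop) (by fun_prop)

theorem closed_cstar [Star T] [ContinuousStar T] :
    IsClosed {x : T | ‖x‖ * ‖x‖ ≤ ‖star x * x‖} :=
  isClosed_le (by fun_prop) (by fun_prop)

end Closed

end SpatialTensorProduct

open SpatialTensorProduct


/-- The completed spatial tensor product `A ⊗ B` of two unital C*-algebras: the completion of `A ⊙ B`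
in the spatial norm. -/
def SpatialTensor (A B : Type u) [CStarAlgebra A] [CStarAlgebra B] : Type u :=
  Completion (Pre A B)

namespace SpatialTensor

section Instances

variable (A B : Type u) [CStarAlgebra A] [CStarAlgebra B]

@[reducible] def normedRing : NormedRing (SpatialTensor A B) := inferInstanceAs (NormedRing (Completion (Pre A B)))

attribute [local instance] normedRing

theorem completeSpace : CompleteSpace (SpatialTensor A B) :=
  inferInstanceAs (CompleteSpace (Completion (Pre A B)))

attribute [local instance] completeSpace

@[reducible] def normedSpace : NormedSpace ℂ (SpatialTensor A B) :=
  inferInstanceAs (NormedSpace ℂ (Completion (Pre A B)))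

attribute [local instance] normedSpace

variable {A B}

/-- The canonical map `A ⊙ B → A ⊗ B`. -/
def ofPre : Pre A B → SpatialTensor A B := fun t => (t : Completion (Pre A B))

theorem norm_ofPre (t : Pre A B) : ‖ofPre t‖ = ‖t‖ := Completion.norm_coe t

theorem continuous_ofPre : Continuous (ofPre : Pre A B → SpatialTensor A B) :=
  Completion.continuous_coe _

theorem dense_ofPre : DenseRange (ofPre : Pre A B → SpatialTensor A B) :=
  Completion.denseRange_coe

theorem ofPre_mul (s t : Pre A B) : ofPre (s * t) = ofPre s * ofPre t := Completion.coe_mul s t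
theorem ofPre_add (s t : Pre A B) : ofPre (s + t) = ofPre s + ofPre t := Completion.coe_add s t
theorem ofPre_one : ofPre (1 : Pre A B) = 1 := rfl
theorem ofPre_zero : ofPre (0 : Pre A B) = 0 := rfl
theorem ofPre_smul (r : ℂ) (t : Pre A B) : ofPre (r • t) = r • ofPre t := Completion.coe_smul r t

@[reducible] def algebra : Algebra ℂ (SpatialTensor A B) :=
  Algebra.ofModule
    (fun r x y => dense_ofPre.induction_on₂ (closed_smul_mul r)
      (fun x y => by simp only [← ofPre_smul, ← ofPre_mul, smul_mul_assoc]) x y)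
    (fun r x y => dense_ofPre.induction_on₂ (closed_mul_smul r)
      (fun x y => by simp only [← ofPre_smul, ← ofPre_mul, mul_smul_comm]) x y)

attribute [local instance] algebra

@[reducible] def normedAlgebra : NormedAlgebra ℂ (SpatialTensor A B) where
  norm_smul_le r x := norm_smul_le r x

attribute [local instance] normedAlgebra

theorem isometry_star_pre : Isometry (star : Pre A B → Pre A B) :=
  AddMonoidHomClass.isometry_of_norm (starAddEquiv : Pre A B ≃+ Pre A B) norm_star_pre

@[reducible] def hasStar : Star (SpatialTensor A B) :=
  ⟨(Completion.map (star : Pre A B → Pre A B) : Completion (Pre A B) → Completion (Pre A B))⟩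

attribute [local instance] hasStar

theorem star_ofPre (t : Pre A B) : star (ofPre t) = ofPre (star t) :=
  Completion.map_coe isometry_star_pre.uniformContinuous t

theorem continuous_star' : Continuous (star : SpatialTensor A B → SpatialTensor A B) :=
  Completion.continuous_map

theorem continuousStar : ContinuousStar (SpatialTensor A B) := ⟨continuous_star'⟩

attribute [local instance] continuousStar

@[reducible] def starRing : StarRing (SpatialTensor A B) where
  star_involutive x := by
    induction x using dense_ofPre.induction_on with
    | hp => exact isClosed_eq (by fun_prop) (by fun_prop)
    | ih x => simp only [star_ofPre, star_star]
  star_mul x y := by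
    induction x, y using dense_ofPre.induction_on₂ with
    | hp => exact closed_star_mul
    | h x y => simp only [star_ofPre, ← ofPre_mul, star_mul]
  star_add x y := by
    induction x, y using dense_ofPre.induction_on₂ with
    | hp => exact isClosed_eq (by fun_prop) (by fun_prop)
    | h x y => simp only [star_ofPre, ← ofPre_add, star_add]

attribute [local instance] starRing

instance : CStarAlgebra (SpatialTensor A B) where
  norm_mul_self_le x := by
    induction x using dense_ofPre.induction_on with
    | hp => exact closed_cstar
    | ih x =>
      rw [star_ofPre, ← ofPre_mul, norm_ofPre, norm_ofPre]
      exact spatialNorm_star_mul_self _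
  star_smul r x := by
    induction x using dense_ofPre.induction_on with
    | hp => exact closed_star_smul r
    | ih x => simp only [star_ofPre, ← ofPre_smul, star_smul]

/-- The order of the C*-algebra `A ⊗ B`: `x ≤ y` iff `y - x` is positive. -/
instance : PartialOrder (SpatialTensor A B) := CStarAlgebra.spectralOrder _
instance : StarOrderedRing (SpatialTensor A B) := CStarAlgebra.spectralOrderedRing _

end Instances

section Maps

variable {A B A' B' C : Type u} [CStarAlgebra A] [CStarAlgebra B] [CStarAlgebra A']
  [CStarAlgebra B'] [CStarAlgebra C]

/-- The elementary tensor `a ⊗ b`. -/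
def tmul (a : A) (b : B) : SpatialTensor A B := ofPre (a ⊗ₜ[ℂ] b : A ⊗[ℂ] B)

/-- The canonical `*`-homomorphism `A ⊙ B → A ⊗ B`. -/
def ofAlg : A ⊗[ℂ] B →⋆ₐ[ℂ] SpatialTensor A B where
  toFun t := ofPre t
  map_one' := rfl
  map_mul' := ofPre_mul
  map_zero' := rfl
  map_add' := ofPre_add
  commutes' r := by
    rw [Algebra.algebraMap_eq_smul_one, Algebra.algebraMap_eq_smul_one]
    exact ofPre_smul r 1
  map_star' t := (star_ofPre t).symm

theorem norm_ofAlg (t : A ⊗[ℂ] B) : ‖ofAlg t‖ = spatialNorm t := norm_ofPre t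

theorem dense_ofAlg : DenseRange (ofAlg : A ⊗[ℂ] B → SpatialTensor A B) := dense_ofPre

theorem ofAlg_tmul (a : A) (b : B) : ofAlg (a ⊗ₜ[ℂ] b) = tmul a b := rfl

/-- The extension to `A ⊗ B` of a bounded linear map on `A ⊙ B`. -/
def extendCLM {E : Type*} [NormedAddCommGroup E] [NormedSpace ℂ E] [CompleteSpace E]
    (φ : A ⊗[ℂ] B →ₗ[ℂ] E) (c : ℝ) (h : ∀ t, ‖φ t‖ ≤ c * spatialNorm t) : SpatialTensor A B →L[ℂ] E :=
  ContinuousLinearMap.fromCompletion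
    (LinearMap.mkContinuous (show Pre A B →ₗ[ℂ] E from φ) c h)

theorem extendCLM_ofAlg {E : Type*} [NormedAddCommGroup E] [NormedSpace ℂ E] [CompleteSpace E]
    (φ : A ⊗[ℂ] B →ₗ[ℂ] E) (c : ℝ) (h : ∀ t, ‖φ t‖ ≤ c * spatialNorm t) (t : A ⊗[ℂ] B) :
    extendCLM φ c h (ofAlg t) = φ t :=
  ContinuousLinearMap.fromCompletion_apply_coe (LinearMap.mkContinuous (show Pre A B →ₗ[ℂ] E from φ) c h) t

/-- The extension to `A ⊗ B` of a contractive `*`-homomorphism on `A ⊙ B`. -/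
def extendHom (φ : A ⊗[ℂ] B →⋆ₐ[ℂ] C) (h : ∀ t, ‖φ t‖ ≤ spatialNorm t) :
    SpatialTensor A B →⋆ₐ[ℂ] C :=
  let F := extendCLM φ.toAlgHom.toLinearMap 1 (fun t => (h t).trans (one_mul _).ge)
  have hF (t : A ⊗[ℂ] B) : F (ofAlg t) = φ t := extendCLM_ofAlg _ _ _ t
  { toFun := F
    map_one' := by rw [← map_one ofAlg, hF, map_one]
    map_mul' := fun x y => by
      induction x, y using dense_ofAlg.induction_on₂ with
      | hp => exact isClosed_eq (by fun_prop) (by fun_prop)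
      | h x y => rw [← map_mul, hF, hF, hF, map_mul]
    map_zero' := map_zero F
    map_add' := map_add F
    commutes' := fun r => by
      rw [Algebra.algebraMap_eq_smul_one, Algebra.algebraMap_eq_smul_one, map_smul,
        ← map_one ofAlg, hF, map_one]
    map_star' := fun x => by
      induction x using dense_ofAlg.induction_on with
      | hp => exact isClosed_eq (by fun_prop) (by fun_prop)
      | ih x => rw [← map_star, hF, hF, map_star] }

theorem extendHom_ofAlg (φ : A ⊗[ℂ] B →⋆ₐ[ℂ] C) (h : ∀ t, ‖φ t‖ ≤ spatialNorm t)
    (t : A ⊗[ℂ] B) : extendHom φ h (ofAlg t) = φ t :=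
  extendCLM_ofAlg φ.toAlgHom.toLinearMap _ _ t

/-- The algebraic tensor product of two `*`-homomorphisms. -/
def algMap (f : A →⋆ₐ[ℂ] A') (g : B →⋆ₐ[ℂ] B') : A ⊗[ℂ] B →⋆ₐ[ℂ] A' ⊗[ℂ] B' where
  __ := Algebra.TensorProduct.map f.toAlgHom g.toAlgHom
  map_star' t := by
    change Algebra.TensorProduct.map f.toAlgHom g.toAlgHom (star t)
      = star (Algebra.TensorProduct.map f.toAlgHom g.toAlgHom t)
    induction t with
    | zero => simp
    | add s t hs ht => rw [star_add, map_add, map_add, star_add, hs, ht]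
    | tmul a b =>
      simp only [TensorProduct.star_tmul, Algebra.TensorProduct.map_tmul]
      congr 1
      · exact map_star f a
      · exact map_star g b

theorem algMap_tmul (f : A →⋆ₐ[ℂ] A') (g : B →⋆ₐ[ℂ] B') (a : A) (b : B) :
    algMap f g (a ⊗ₜ b) = f a ⊗ₜ g b := rfl

theorem preTens_algMap (f : A →⋆ₐ[ℂ] A') (g : B →⋆ₐ[ℂ] B') (ρ : Rep A') (σ : Rep B')
    (t : A ⊗[ℂ] B) : preTens ρ σ (algMap f g t)
      = preTens (⟨ρ.H, ρ.π.comp f⟩ : Rep A) (⟨σ.H, σ.π.comp g⟩ : Rep B) t := by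
  induction t with
  | zero => simp only [map_zero]
  | add s t hs ht => simp only [map_add, hs, ht]
  | tmul a b => rw [algMap_tmul, preTens_tmul, preTens_tmul]; rfl

theorem spatialNorm_algMap_le (f : A →⋆ₐ[ℂ] A') (g : B →⋆ₐ[ℂ] B') (t : A ⊗[ℂ] B) :
    spatialNorm (algMap f g t) ≤ spatialNorm t :=
  spatialNorm_le (spatialNorm_nonneg t) fun ρ σ => by
    rw [norm_tens, preTens_algMap, ← norm_tens (⟨ρ.H, ρ.π.comp f⟩ : Rep A)]
    exact norm_tens_le _ _ _

/-- The tensor product `f ⊗ g : A ⊗ B → A' ⊗ B'` of two `*`-homomorphisms. -/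
def map (f : A →⋆ₐ[ℂ] A') (g : B →⋆ₐ[ℂ] B') : SpatialTensor A B →⋆ₐ[ℂ] SpatialTensor A' B' :=
  extendHom (ofAlg.comp (algMap f g)) fun t =>
    (norm_ofAlg (algMap f g t)).trans_le (spatialNorm_algMap_le f g t)

theorem map_tmul (f : A →⋆ₐ[ℂ] A') (g : B →⋆ₐ[ℂ] B') (a : A) (b : B) :
    map f g (tmul a b) = tmul (f a) (g b) :=
  extendHom_ofAlg _ _ (a ⊗ₜ b)

/-- The algebraic flip. -/
def algFlip : A ⊗[ℂ] B →⋆ₐ[ℂ] B ⊗[ℂ] A where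
  __ := (Algebra.TensorProduct.comm ℂ A B).toAlgHom
  map_star' t := by
    change Algebra.TensorProduct.comm ℂ A B (star t) = star (Algebra.TensorProduct.comm ℂ A B t)
    induction t with
    | zero => simp
    | add s t hs ht => rw [star_add, map_add, map_add, star_add, hs, ht]
    | tmul a b => rfl

theorem algFlip_tmul (a : A) (b : B) : algFlip (a ⊗ₜ[ℂ] b) = b ⊗ₜ a := rfl

theorem preTens_algFlip (ρ : Rep B) (σ : Rep A) (t : A ⊗[ℂ] B) (x : σ.H ⊗[ℂ] ρ.H) :
    preTens ρ σ (algFlip t) (TensorProduct.comm ℂ σ.H ρ.H x)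
      = TensorProduct.comm ℂ σ.H ρ.H (preTens σ ρ t x) := by
  induction t with
  | zero => simp
  | add s t hs ht => simp [hs, ht]
  | tmul a b =>
    rw [algFlip_tmul, preTens_tmul, preTens_tmul]
    induction x with
    | zero => simp
    | add x y hx hy => simp only [map_add, hx, hy]
    | tmul p q => rfl

theorem spatialNorm_algFlip_le (t : A ⊗[ℂ] B) : spatialNorm (algFlip t) ≤ spatialNorm t :=
  spatialNorm_le (spatialNorm_nonneg t) fun ρ σ => by
    rw [norm_tens]
    refine le_trans ?_ (norm_tens_le σ ρ t)
    rw [norm_tens]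
    refine ContinuousLinearMap.opNorm_le_bound _ (preTens σ ρ t).opNorm_nonneg fun y => ?_
    obtain ⟨x, rfl⟩ := (TensorProduct.comm ℂ σ.H ρ.H).surjective y
    rw [preTens_algFlip, TensorProduct.norm_comm, TensorProduct.norm_comm]
    exact (preTens σ ρ t).le_opNorm x

/-- The flip `A ⊗ B → B ⊗ A`, `a ⊗ b ↦ b ⊗ a`. -/
def flip : SpatialTensor A B →⋆ₐ[ℂ] SpatialTensor B A :=
  extendHom (ofAlg.comp algFlip) fun t =>
    (norm_ofAlg (algFlip t)).trans_le (spatialNorm_algFlip_le t)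

theorem flip_tmul (a : A) (b : B) : flip (tmul a b) = tmul b a :=
  extendHom_ofAlg _ _ (a ⊗ₜ b)

variable (A B) in
/-- The embedding `A → A ⊗ B`, `a ↦ a ⊗ 1`. -/
def inl : A →⋆ₐ[ℂ] SpatialTensor A B where
  __ := ofAlg.toAlgHom.comp (Algebra.TensorProduct.includeLeft : A →ₐ[ℂ] A ⊗[ℂ] B)
  map_star' a := by
    change ofAlg (star a ⊗ₜ[ℂ] (1 : B)) = star (ofAlg (a ⊗ₜ[ℂ] (1 : B)))
    rw [← map_star, TensorProduct.star_tmul, star_one]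

variable (A B) in
/-- The embedding `B → A ⊗ B`, `b ↦ 1 ⊗ b`. -/
def inr : B →⋆ₐ[ℂ] SpatialTensor A B where
  __ := ofAlg.toAlgHom.comp (Algebra.TensorProduct.includeRight : B →ₐ[ℂ] A ⊗[ℂ] B)
  map_star' b := by
    change ofAlg ((1 : A) ⊗ₜ[ℂ] star b) = star (ofAlg ((1 : A) ⊗ₜ[ℂ] b))
    rw [← map_star, TensorProduct.star_tmul, star_one]

theorem inl_apply (a : A) : inl A B a = tmul a 1 := rfl
theorem inr_apply (b : B) : inr A B b = tmul 1 b := rfl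

end Maps

end SpatialTensor

section States

variable {A B : Type u} [CStarAlgebra A] [CStarAlgebra B]

/-- A state of a unital C*-algebra: a positive linear functional `μ` with `μ 1 = 1`. -/
structure CStarState (A : Type u) [CStarAlgebra A] where
  toLinearMap : A →ₗ[ℂ] ℂ
  nonneg : ∀ a, 0 ≤ toLinearMap (star a * a)
  map_one : toLinearMap 1 = 1

instance : CoeFun (CStarState A) (fun _ => A → ℂ) := ⟨fun μ => μ.toLinearMap⟩

namespace CStarState

/-- The vector state `a ↦ ⟪ξ, π(a) ξ⟫` of a unit vector `ξ`. -/
def ofVector (ρ : Rep A) (ξ : ρ.H) (hξ : ‖ξ‖ = 1) : CStarState A where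
  toLinearMap := (innerₛₗ ℂ ξ).comp
    ((ContinuousLinearMap.apply ℂ ρ.H ξ).toLinearMap.comp ρ.π.toAlgHom.toLinearMap)
  nonneg a := by
    change 0 ≤ inner ℂ ξ (ρ.π (star a * a) ξ)
    rw [map_mul, map_star, ContinuousLinearMap.star_eq_adjoint, mul_apply_eq_comp,
      ContinuousLinearMap.adjoint_inner_right, inner_self_eq_norm_sq_to_K]
    have h : (0 : ℂ) ≤ ((‖ρ.π a ξ‖ ^ 2 : ℝ) : ℂ) := Complex.zero_le_real.mpr (sq_nonneg _)
    rwa [Complex.ofReal_pow] at h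
  map_one := by
    change inner ℂ ξ (ρ.π 1 ξ) = 1
    rw [_root_.map_one, one_apply_eq_self, inner_self_eq_norm_sq_to_K, hξ]
    simp

theorem ofVector_apply (ρ : Rep A) (ξ : ρ.H) (hξ : ‖ξ‖ = 1) (a : A) :
    ofVector ρ ξ hξ a = inner ℂ ξ (ρ.π a ξ) := rfl

/-- A state as a positive linear map. -/
@[reducible] def toPositive (μ : CStarState A) :
    letI := CStarAlgebra.spectralOrder A
    A →ₚ[ℂ] ℂ :=
  letI := CStarAlgebra.spectralOrder A
  haveI := CStarAlgebra.spectralOrderedRing A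
  PositiveLinearMap.mk₀ μ.toLinearMap fun x hx => by
    obtain ⟨s, rfl⟩ := CStarAlgebra.nonneg_iff_eq_star_mul_self.mp hx
    exact μ.nonneg s

/-- The Gelfand-Naimark-Segal representation of a state. -/
def gns (μ : CStarState A) : Rep A :=
  letI := CStarAlgebra.spectralOrder A
  haveI := CStarAlgebra.spectralOrderedRing A
  { H := μ.toPositive.GNS
    π := μ.toPositive.gnsStarAlgHom }

/-- The canonical cyclic vector of the Gelfand-Naimark-Segal representation. -/
def gnsVector (μ : CStarState A) : μ.gns.H :=
  letI := CStarAlgebra.spectralOrder A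
  haveI := CStarAlgebra.spectralOrderedRing A
  ((μ.toPositive.toPreGNS 1 : μ.toPositive.PreGNS) : μ.toPositive.GNS)

theorem inner_gnsVector (μ : CStarState A) (a : A) :
    inner ℂ μ.gnsVector (μ.gns.π a μ.gnsVector) = μ a := by
  let _ := CStarAlgebra.spectralOrder A
  have := CStarAlgebra.spectralOrderedRing A
  change inner ℂ ((μ.toPositive.toPreGNS 1 : μ.toPositive.PreGNS) : μ.toPositive.GNS)
    (μ.toPositive.gnsNonUnitalStarAlgHom a
      ((μ.toPositive.toPreGNS 1 : μ.toPositive.PreGNS) : μ.toPositive.GNS)) = μ a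
  rw [PositiveLinearMap.gnsNonUnitalStarAlgHom_apply_coe, Completion.inner_coe,
    PositiveLinearMap.preGNS_inner_def]
  simp
  rfl

theorem norm_gnsVector (μ : CStarState A) : ‖μ.gnsVector‖ = 1 := by
  have h := μ.inner_gnsVector 1
  rw [_root_.map_one, one_apply_eq_self, inner_self_eq_norm_sq_to_K, μ.map_one] at h
  have h2 : ((‖μ.gnsVector‖ ^ 2 : ℝ) : ℂ) = 1 := by rw [Complex.ofReal_pow]; exact h
  exact (pow_eq_one_iff_of_nonneg (norm_nonneg _) two_ne_zero).mp (Complex.ofReal_eq_one.mp h2)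

/-- The representation `π ⊗ σ` of the completed tensor product. -/
def _root_.SpatialTensorProduct.Rep.tensor (ρ : Rep A) (σ : Rep B) : Rep (SpatialTensor A B) where
  H := HTens ρ σ
  π := SpatialTensor.extendHom (tens ρ σ) (norm_tens_le ρ σ)

/-- The product state `μ ⊗ ν` of `A ⊗ B`. -/
def prod (μ : CStarState A) (ν : CStarState B) : CStarState (SpatialTensor A B) :=
  ofVector (μ.gns.tensor ν.gns) (HTens.incl μ.gns ν.gns (μ.gnsVector ⊗ₜ ν.gnsVector)) <|
    ((HTens.incl μ.gns ν.gns).norm_map _).trans <| by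
      rw [TensorProduct.norm_tmul, norm_gnsVector, norm_gnsVector, one_mul]

theorem prod_tmul (μ : CStarState A) (ν : CStarState B) (a : A) (b : B) :
    μ.prod ν (SpatialTensor.tmul a b) = μ a * ν b := by
  refine (ofVector_apply (μ.gns.tensor ν.gns) _ _ _).trans ?_
  change inner ℂ (HTens.incl μ.gns ν.gns (μ.gnsVector ⊗ₜ ν.gnsVector))
    (SpatialTensor.extendHom (tens μ.gns ν.gns) (norm_tens_le μ.gns ν.gns)
      (SpatialTensor.ofAlg (a ⊗ₜ b)) (HTens.incl μ.gns ν.gns (μ.gnsVector ⊗ₜ ν.gnsVector))) = _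
  rw [SpatialTensor.extendHom_ofAlg, tens_incl, LinearIsometry.inner_map_map, preTens_tmul,
    TensorProduct.mapL_tmul, TensorProduct.inner_tmul, inner_gnsVector, inner_gnsVector]

end CStarState

end States

section MetricOperatorFields

open SpatialTensor

variable {X Y : Type v}

/-- An operator field on the bundle `A` assigns to every point `x` an element of `A x`. -/
abbrev OperatorField (A : X → Type u) := ∀ x, A x

/-- The bundle `(x, y) ↦ A x ⊗ B y` over `X × Y`. -/
abbrev TensorBundle (A : X → Type u) (B : Y → Type u) [∀ x, CStarAlgebra (A x)]
    [∀ y, CStarAlgebra (B y)] : X × Y → Type u :=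
  fun p => SpatialTensor (A p.1) (B p.2)

/-- The supremum norm `‖f‖_∞`, with values in `[0, ∞]`. -/
def supNorm (A : X → Type u) [∀ x, CStarAlgebra (A x)] (f : OperatorField A) : ℝ≥0∞ :=
  ⨆ x, ‖f x‖ₑ

variable (A : X → Type u) [∀ x, CStarAlgebra (A x)]
variable (B : Y → Type u) [∀ y, CStarAlgebra (B y)]

/-- Metric operator fields. In the triangle inequality, which is read in
`(A x ⊗ A x') ⊗ A x''`, the three terms are `D(x, x'')` with a unit in the middle,
`D(x, x') ⊗ 1` and `1 ⊗ D(x', x'')`. -/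
structure IsMof (D : OperatorField (TensorBundle A A)) : Prop where
  metricStates : ∃ μ : ∀ x, CStarState (A x), ∀ x, (μ x).prod (μ x) (D (x, x)) = 0
  pos : ∀ x x', x ≠ x' → (0 : SpatialTensor (A x) (A x')) ≤ D (x, x') ∧
    IsUnit (D (x, x') : SpatialTensor (A x) (A x'))
  symm : ∀ x x', D (x, x') = flip (A := A x') (B := A x) (D (x', x))
  triangle : ∀ x x' x'',
    map (inl (A x) (A x')) (StarAlgHom.id ℂ (A x'')) (D (x, x'')) ≤
      inl (SpatialTensor (A x) (A x')) (A x'') (D (x, x')) +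
        map (inr (A x) (A x')) (StarAlgHom.id ℂ (A x'')) (D (x', x''))

/-- The subalgebra `Z(A) ⊗ Z(B)` of `A ⊗ B`: the closed linear span of the `z ⊗ w` with `z`, `w`
central. -/
def centerTensor (A B : Type u) [CStarAlgebra A] [CStarAlgebra B] : Set (SpatialTensor A B) :=
  closure (Submodule.span ℂ
    {t | ∃ z ∈ Subalgebra.center ℂ A, ∃ w ∈ Subalgebra.center ℂ B, t = tmul z w} :
      Set (SpatialTensor A B))

/-- Central metric operator fields. -/
structure IsCentralMof (D : OperatorField (TensorBundle A A)) : Prop extends IsMof A D where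
  central : ∀ x x', D (x, x') ∈ centerTensor (A x) (A x')

/-- The product `D × R`, an operator field on `(A ⊗ B) ⊗ (A ⊗ B)`. Its value at
`((x, y), (x', y'))` is `D(x, x')` placed in the factors `A x`, `A x'` plus `R(y, y')` placed in the
factors `B y`, `B y'` of `(A x ⊗ B y) ⊗ (A x' ⊗ B y')`. -/
def prodMof (D : OperatorField (TensorBundle A A)) (R : OperatorField (TensorBundle B B)) :
    OperatorField (TensorBundle (TensorBundle A B) (TensorBundle A B)) := fun q =>
  map (inl (A q.1.1) (B q.1.2)) (inl (A q.2.1) (B q.2.2)) (D (q.1.1, q.2.1)) +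
    map (inr (A q.1.1) (B q.1.2)) (inr (A q.2.1) (B q.2.2)) (R (q.1.2, q.2.2))

/-- The element `d^{-1/2} (a ⊗ 1 - 1 ⊗ b) d^{-1/2}` of `A ⊗ B`, for `d` positive and invertible. -/
def lipQuotient {A B : Type u} [CStarAlgebra A] [CStarAlgebra B] (d : SpatialTensor A B) (a : A)
    (b : B) : SpatialTensor A B :=
  d ^ (-1 / 2 : ℝ) * (inl A B a - inr A B b) * d ^ (-1 / 2 : ℝ)

/-- The Lipschitz seminorm
`‖f‖_D = sup_{x ≠ x'} ‖D(x,x')^{-1/2} (f(x) ⊗ 1 - 1 ⊗ f(x')) D(x,x')^{-1/2}‖` in `[0, ∞]`. -/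
def lipNorm (D : OperatorField (TensorBundle A A)) (f : OperatorField A) : ℝ≥0∞ :=
  ⨆ (x : X) (x' : X) (_ : x ≠ x'), ‖lipQuotient (D (x, x')) (f x) (f x')‖ₑ

/-- `f` is a Lipschitz operator field with respect to `D`. -/
def IsLipschitz (D : OperatorField (TensorBundle A A)) (f : OperatorField A) : Prop :=
  lipNorm A D f < ⊤

/-- `f` and `D` commute. -/
def FieldCommutes (D : OperatorField (TensorBundle A A)) (f : OperatorField A) : Prop :=
  ∀ x x', Commute (S := SpatialTensor (A x) (A x')) (D (x, x')) (inl (A x) (A x') (f x))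

/-- The Lipschitz algebra `Lip(D)`: the bounded Lipschitz operator fields that commute with `D`. -/
def lipAlgebra (D : OperatorField (TensorBundle A A)) : Set (OperatorField A) :=
  {f | supNorm A f < ⊤ ∧ IsLipschitz A D f ∧ FieldCommutes A D f}

end MetricOperatorFields

end

/-! Centrality reduces the operator inequalities to inequalities between numbers. For states `α` of
`A x` and `β` of `A y` put `d(α, β) = (α ⊗ β)(D(x, y))`. Applying product states to the flip axiom
and to the triangle inequality shows that `d` is symmetric and satisfies the triangle inequality,
hence is nonnegative and satisfies `|d(α, β) - d(γ, δ)| ≤ d(α, γ) + d(β, δ)`.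

The elements `D p ⊗ 1 - 1 ⊗ D q` and `(D × D)(p, q)` lie in the center of a fourfold tensor product.
A central element is positive as soon as every state that is multiplicative on the center is
nonnegative on it (`nonneg_of_forall_mulOnCenter`). Such a state acts on each copy of `D` as the
product of its own marginals `α`, `β`, `γ`, `δ` (`IsPlacement.apply_state`), so the scalar
inequality gives `-(D × D)(p, q) ≤ D p ⊗ 1 - 1 ⊗ D q ≤ (D × D)(p, q)`. Conjugation by the inverse
square root turns this into the bound 1 for the norm (`norm_conj_le_iff`).

The bound is attained at `p = (x, y)`, `q = (y, y)` with `x ≠ y`. On the product of the metric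
states, `D q` and the second summand of `D × D` vanish, while `D p` and the first summand take the
same positive value, so no constant below 1 suffices (`one_le_norm_lipQuotient`). -/

/-! ### Norm-one functionals, and positivity of central elements. -/

section CStarFacts

variable {W : Type*} [CStarAlgebra W]

/-- Shifting `a` by `i t` adds `t` to the imaginary part of `f a`, but raises the squared norm of
`a` by at most `t ^ 2`. The cross term `2 t Im (f a)` is therefore bounded above over all real `t`,
which forces it to vanish. -/
theorem im_apply_eq_zero_of_isSelfAdjoint {f : StrongDual ℂ W} (hf : ‖f‖ ≤ 1) (h1 : f 1 = 1)
    {a : W} (ha : IsSelfAdjoint a) : (f a).im = 0 := by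
  have key (t : ℝ) : (f a).re ^ 2 + ((f a).im + t) ^ 2 ≤ ‖a‖ ^ 2 + t ^ 2 * ‖(1 : W)‖ := by
    have e : f (a + ((t : ℂ) * Complex.I) • (1 : W)) = f a + t * Complex.I := by
      rw [map_add, map_smul, h1, smul_eq_mul, mul_one]
    have h2 : ‖f (a + ((t : ℂ) * Complex.I) • (1 : W))‖ ≤ ‖a + ((t : ℂ) * Complex.I) • (1 : W)‖ :=
      (f.le_opNorm _).trans (mul_le_of_le_one_left (norm_nonneg _) hf)
    have h3 : star (a + ((t : ℂ) * Complex.I) • (1 : W)) * (a + ((t : ℂ) * Complex.I) • (1 : W))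
        = a * a + ((t ^ 2 : ℝ) : ℂ) • (1 : W) := by
      have hI : ((t : ℂ) * Complex.I) * ((t : ℂ) * Complex.I) = -((t : ℂ) ^ 2) := by
        linear_combination (t : ℂ) ^ 2 * Complex.I_mul_I
      simp [ha.star_eq, add_mul, mul_add, smul_smul, hI, add_assoc]
    have h4 : ‖a + ((t : ℂ) * Complex.I) • (1 : W)‖ ^ 2 ≤ ‖a‖ ^ 2 + t ^ 2 * ‖(1 : W)‖ := by
      rw [sq, ← CStarRing.norm_star_mul_self, h3]
      refine (norm_add_le _ _).trans (add_le_add ?_ ?_)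
      · rw [sq]; exact norm_mul_le _ _
      · rw [norm_smul, Complex.norm_real, Real.norm_of_nonneg (sq_nonneg t)]
    have h5 : ‖f a + t * Complex.I‖ ^ 2 = (f a).re ^ 2 + ((f a).im + t) ^ 2 := by
      rw [Complex.sq_norm, Complex.normSq_apply]
      simp
      ring
    rw [← h5, ← e]
    exact (pow_le_pow_left₀ (norm_nonneg _) h2 2).trans h4
  -- Only an inequality, since `W` may be the zero algebra.
  have hone : ‖(1 : W)‖ ≤ 1 := by
    rcases subsingleton_or_nontrivial W with h | h
    · simp [Subsingleton.elim (1 : W) 0]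
    · exact CStarRing.norm_one.le
  by_contra hne
  -- This `t` makes the cross term equal to `‖a‖ ^ 2 + 1`, which exceeds the available `‖a‖ ^ 2`.
  have h6 := key ((‖a‖ ^ 2 + 1) / (2 * (f a).im))
  have h7 : 2 * (f a).im * ((‖a‖ ^ 2 + 1) / (2 * (f a).im)) = ‖a‖ ^ 2 + 1 := by
    field_simp
  nlinarith [sq_nonneg (f a).re, sq_nonneg (f a).im,
    mul_le_of_le_one_right (sq_nonneg ((‖a‖ ^ 2 + 1) / (2 * (f a).im))) hone]

/-- For `b = star a * a` one has `0 ≤ ‖b‖ - b ≤ ‖b‖`, so `f b` lies in the disc of radius `‖b‖`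
about `‖b‖`, which is in the right half-plane. -/
theorem nonneg_apply_star_mul_self {f : StrongDual ℂ W} (hf : ‖f‖ ≤ 1) (h1 : f 1 = 1) (a : W) :
    0 ≤ f (star a * a) := by
  let _ := CStarAlgebra.spectralOrder W
  have := CStarAlgebra.spectralOrderedRing W
  set b := star a * a with hb
  have hb0 : 0 ≤ b := star_mul_self_nonneg a
  have hle : ‖algebraMap ℝ W ‖b‖ - b‖ ≤ ‖b‖ := by
    have h2 := hb0.isSelfAdjoint.le_algebraMap_norm_self
    rw [CStarAlgebra.norm_le_iff_le_algebraMap _ (norm_nonneg _) (sub_nonneg.2 h2)]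
    exact sub_le_self _ hb0
  have e : f (algebraMap ℝ W ‖b‖ - b) = ‖b‖ - f b := by
    rw [map_sub, Algebra.algebraMap_eq_smul_one, ← Complex.coe_smul, map_smul, h1, smul_eq_mul,
      mul_one]
  have h3 : ‖(‖b‖ : ℂ) - f b‖ ≤ ‖b‖ := by
    rw [← e]
    exact ((f.le_opNorm _).trans (mul_le_of_le_one_left (norm_nonneg _) hf)).trans hle
  have h4 := (Complex.re_le_norm _).trans h3
  rw [Complex.nonneg_iff]
  refine ⟨?_, (im_apply_eq_zero_of_isSelfAdjoint hf h1 hb0.isSelfAdjoint).symm⟩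
  simp at h4
  exact h4

/-- The center of a C*-algebra, as a `*`-subalgebra. -/
def starCenter (W : Type*) [CStarAlgebra W] : StarSubalgebra ℂ W :=
  StarSubalgebra.centralizer ℂ Set.univ

theorem mem_starCenter {z : W} : z ∈ starCenter W ↔ ∀ a, a * z = z * a := by
  rw [starCenter, StarSubalgebra.mem_centralizer_iff]
  exact ⟨fun h a => (h a trivial).1, fun h a _ => ⟨h a, h (star a)⟩⟩

theorem isClosed_starCenter : IsClosed (starCenter W : Set W) := by
  rw [starCenter, StarSubalgebra.coe_centralizer]
  exact Set.isClosed_centralizer _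

/-- A Hahn-Banach extension keeps the norm at most 1 and the value 1 at the unit, and these two
facts already make it positive. Multiplicativity survives only on the center. -/
theorem exists_state_of_character (φ : (starCenter W) →⋆ₐ[ℂ] ℂ) :
    ∃ Ψ : CStarState W, ∀ z : starCenter W, Ψ z = φ z := by
  have : IsClosed (starCenter W : Set W) := isClosed_starCenter
  have hb (x : starCenter W) : ‖φ x‖ ≤ 1 * ‖x‖ :=
    (NonUnitalStarAlgHom.norm_apply_le φ x).trans (one_mul _).ge
  let F : StrongDual ℂ (starCenter W).toSubmodule :=
    LinearMap.mkContinuous (φ : (starCenter W) →ₗ[ℂ] ℂ) 1 hb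
  obtain ⟨g, hg, hn⟩ := exists_extension_norm_eq _ F
  have hg1 : ‖g‖ ≤ 1 := hn.trans_le (LinearMap.mkContinuous_norm_le _ zero_le_one _)
  have h1 : g 1 = 1 := (hg ⟨1, one_mem (starCenter W)⟩).trans (map_one φ)
  exact ⟨⟨g, nonneg_apply_star_mul_self hg1 h1, h1⟩, fun z => hg ⟨z, z.2⟩⟩

/-- A state that is multiplicative on the center. -/
def CStarState.MulOnCenter (Ψ : CStarState W) : Prop :=
  ∀ z ∈ starCenter W, ∀ w ∈ starCenter W, Ψ (z * w) = Ψ z * Ψ w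

/-- The center is a commutative C*-algebra, so every spectral value of `s` is `φ s` for a character
`φ` of the center, and `φ` extends to a state of `W`. -/
theorem nonneg_of_forall_mulOnCenter [PartialOrder W] [StarOrderedRing W] {s : W}
    (hs : s ∈ starCenter W) (h : ∀ Ψ : CStarState W, Ψ.MulOnCenter → 0 ≤ Ψ s) : 0 ≤ s := by
  have : IsClosed (starCenter W : Set W) := isClosed_starCenter
  let _ : CommCStarAlgebra (starCenter W) :=
    { (inferInstance : CStarAlgebra (starCenter W)) with
      mul_comm := fun a b => Subtype.ext (mem_starCenter.1 b.2 a) }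
  have hspec (z : ℂ) (hz : z ∈ spectrum ℂ s) : 0 ≤ z := by
    -- Spectral permanence: the spectrum is the same in the center as in `W`.
    rw [← StarSubalgebra.mem_spectrum_iff (S := starCenter W) (a := ⟨s, hs⟩) (hS := this)] at hz
    obtain ⟨φ, rfl⟩ := WeakDual.CharacterSpace.mem_spectrum_iff_exists.1 hz
    let φ' : (starCenter W) →⋆ₐ[ℂ] ℂ :=
      { WeakDual.CharacterSpace.equivAlgHom φ with
        map_star' := fun a => map_star φ a }
    obtain ⟨Ψ, hΨ⟩ := exists_state_of_character φ'
    have h2 := h Ψ fun z hz w hw => by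
      rw [hΨ ⟨z, hz⟩, hΨ ⟨w, hw⟩, ← map_mul, ← hΨ]; rfl
    rwa [hΨ ⟨s, hs⟩] at h2
  -- Self-adjointness is not assumed: a central element is normal, and a normal element with real
  -- spectrum is self-adjoint.
  have hn : IsStarNormal s := ⟨mem_starCenter.1 hs (star s)⟩
  have hsa : IsSelfAdjoint s := QuasispectrumRestricts.isSelfAdjoint s <|
    SpectrumRestricts.real_iff.2 fun x hx =>
      Complex.ext rfl (Complex.nonneg_iff.1 (hspec x hx)).2.symm
  rw [StarOrderedRing.nonneg_iff_spectrum_nonneg (R := ℝ) s hsa]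
  intro x hx
  have := hspec x (by simpa using (spectrum.algebraMap_mem ℂ hx))
  simpa using this

/-! ### Order estimates for states and for conjugation by `d ^ (-1 / 2)`. -/

section Quotient

variable [PartialOrder W] [StarOrderedRing W]

theorem CStarState.apply_nonneg (Ψ : CStarState W) {a : W} (h : 0 ≤ a) : 0 ≤ Ψ a := by
  obtain ⟨s, rfl⟩ := CStarAlgebra.nonneg_iff_eq_star_mul_self.mp h
  exact Ψ.nonneg s

theorem CStarState.apply_mono (Ψ : CStarState W) {a b : W} (h : a ≤ b) : Ψ a ≤ Ψ b := by
  rw [← sub_nonneg, ← map_sub]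
  exact Ψ.apply_nonneg (sub_nonneg.2 h)

/-- A positive invertible element dominates `r • 1` for some `r > 0`. -/
theorem CStarState.apply_pos (Ψ : CStarState W) {a : W} (h : 0 ≤ a) (hu : IsUnit a) :
    0 < Ψ a := by
  have : Nontrivial W := ⟨1, 0, fun e => one_ne_zero (Ψ.map_one.symm.trans (by rw [e, map_zero]))⟩
  have ha : IsStrictlyPositive a := hu.isStrictlyPositive h
  obtain ⟨r, hr, hle⟩ := (CFC.exists_pos_algebraMap_le_iff (a := a) ha.isSelfAdjoint).2
    fun x hx => ha.spectrum_pos hx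
  have := Ψ.apply_mono hle
  rw [Algebra.algebraMap_eq_smul_one, ← Complex.coe_smul, map_smul, Ψ.map_one, smul_eq_mul,
    mul_one] at this
  exact (Complex.zero_lt_real.2 hr).trans_le this

theorem norm_le_iff_of_isSelfAdjoint {s : W} (hs : IsSelfAdjoint s) {r : ℝ} (hr : 0 ≤ r) :
    ‖s‖ ≤ r ↔ -(algebraMap ℝ W r) ≤ s ∧ s ≤ algebraMap ℝ W r := by
  constructor
  · intro h
    have h1 : algebraMap ℝ W ‖s‖ ≤ algebraMap ℝ W r := algebraMap_mono W h
    exact ⟨(neg_le_neg h1).trans hs.neg_algebraMap_norm_le_self,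
      hs.le_algebraMap_norm_self.trans h1⟩
  · rintro ⟨h1, h2⟩
    rcases subsingleton_or_nontrivial W with h | h
    · rwa [Subsingleton.elim s 0, norm_zero]
    rw [← map_neg, algebraMap_le_iff_le_spectrum (ha := hs)] at h1
    rw [le_algebraMap_iff_spectrum_le (ha := hs)] at h2
    rcases CStarAlgebra.norm_or_neg_norm_mem_spectrum (a := s) hs with h | h
    · exact h2 _ h
    · exact neg_le_neg_iff.1 (h1 _ h)

/-- The norm bound says that the conjugated element lies between `-r` and `r`. Conjugation by `d ^
(1 / 2)` and by `d ^ (-1 / 2)` preserves order, and the two are mutually inverse, exchanging `r`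
with `r • d`. Both directions are needed: one for the upper bound on the Lipschitz norm, the other
for the lower bound. -/
theorem norm_conj_le_iff {d t : W} (hd : IsStrictlyPositive d) (ht : IsSelfAdjoint t) {r : ℝ}
    (hr : 0 ≤ r) : ‖d ^ (-1 / 2 : ℝ) * t * d ^ (-1 / 2 : ℝ)‖ ≤ r ↔ -(r • d) ≤ t ∧ t ≤ r • d := by
  set c := d ^ (-1 / 2 : ℝ) with hc
  set e := d ^ (1 / 2 : ℝ) with he
  have hcs : IsSelfAdjoint c := .of_nonneg CFC.rpow_nonneg
  have hes : IsSelfAdjoint e := .of_nonneg CFC.rpow_nonneg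
  have hec : e * c = 1 := by
    rw [hc, he, ← CFC.rpow_add hd.isUnit]; norm_num; exact CFC.rpow_zero d hd.nonneg
  have hce : c * e = 1 := by
    rw [hc, he, ← CFC.rpow_add hd.isUnit]; norm_num; exact CFC.rpow_zero d hd.nonneg
  have hee : e * e = d := by
    rw [he, ← CFC.rpow_add hd.isUnit]; norm_num; exact CFC.rpow_one d hd.nonneg
  have hs : IsSelfAdjoint (c * t * c) := by
    simpa only [hcs.star_eq] using ht.conjugate c
  have h1 : c * (r • d) * c = algebraMap ℝ W r := by
    rw [← hee, mul_smul_comm, smul_mul_assoc, ← mul_assoc, hce, one_mul, hec,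
      Algebra.algebraMap_eq_smul_one]
  have h2 : e * algebraMap ℝ W r * e = r • d := by
    rw [Algebra.algebraMap_eq_smul_one, mul_smul_comm, smul_mul_assoc, mul_one, hee]
  have h3 : e * (c * t * c) * e = t := by
    rw [← mul_assoc, ← mul_assoc, hec, one_mul, mul_assoc, hce, mul_one]
  rw [norm_le_iff_of_isSelfAdjoint hs hr]
  constructor
  · rintro ⟨ha, hb⟩
    replace ha := hes.conjugate_le_conjugate ha
    replace hb := hes.conjugate_le_conjugate hb
    rw [h2, h3] at hb
    rw [mul_neg, neg_mul, h2, h3] at ha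
    exact ⟨ha, hb⟩
  · rintro ⟨ha, hb⟩
    replace ha := hcs.conjugate_le_conjugate ha
    replace hb := hcs.conjugate_le_conjugate hb
    rw [h1] at hb
    rw [mul_neg, neg_mul, h1] at ha
    exact ⟨ha, hb⟩

end Quotient

end CStarFacts

/-! ### Product states and their marginals. -/

section TensorFacts

open SpatialTensor

variable {A B C W : Type u} [CStarAlgebra A] [CStarAlgebra B] [CStarAlgebra C] [CStarAlgebra W]

theorem continuous_starAlgHom (F : A →⋆ₐ[ℂ] B) : Continuous F :=
  AddMonoidHomClass.continuous_of_bound F 1 fun x =>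
    (NonUnitalStarAlgHom.norm_apply_le F x).trans (one_mul _).ge

namespace CStarState

theorem continuous (μ : CStarState A) : Continuous μ := by
  let _ := CStarAlgebra.spectralOrder A
  have := CStarAlgebra.spectralOrderedRing A
  exact map_continuous μ.toPositive

/-- The restriction of a state along a unital `*`-homomorphism. -/
noncomputable def comap (μ : CStarState B) (f : A →⋆ₐ[ℂ] B) : CStarState A where
  toLinearMap := μ.toLinearMap.comp f.toAlgHom.toLinearMap
  nonneg a := by
    change 0 ≤ μ (f (star a * a))
    rw [map_mul, map_star]
    exact μ.nonneg _
  map_one := (congrArg μ (_root_.map_one f)).trans μ.map_one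

theorem comap_apply (μ : CStarState B) (f : A →⋆ₐ[ℂ] B) (a : A) : μ.comap f a = μ (f a) := rfl

/-- States are continuous and the algebraic tensor product is dense. -/
theorem ext_tmul {μ ν : CStarState (SpatialTensor A B)}
    (h : ∀ a b, μ (tmul a b) = ν (tmul a b)) (c : SpatialTensor A B) : μ c = ν c := by
  induction c using dense_ofAlg.induction_on with
  | hp => exact isClosed_eq μ.continuous ν.continuous
  | ih t =>
    induction t with
    | zero => simp only [map_zero]
    | add s t hs ht => simp only [map_add, hs, ht]
    | tmul a b => exact h a b

theorem prod_inl (μ : CStarState A) (ν : CStarState B) (a : A) : μ.prod ν (inl A B a) = μ a := by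
  rw [inl_apply, prod_tmul, ν.map_one, mul_one]

theorem prod_inr (μ : CStarState A) (ν : CStarState B) (b : B) : μ.prod ν (inr A B b) = ν b := by
  rw [inr_apply, prod_tmul, μ.map_one, one_mul]

theorem prod_map {A' B' : Type u} [CStarAlgebra A'] [CStarAlgebra B'] (μ : CStarState A')
    (ν : CStarState B') (f : A →⋆ₐ[ℂ] A') (g : B →⋆ₐ[ℂ] B') (c : SpatialTensor A B) :
    μ.prod ν (SpatialTensor.map f g c) = (μ.comap f).prod (ν.comap g) c :=
  ext_tmul (μ := (μ.prod ν).comap (SpatialTensor.map f g)) (fun a b => by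
    rw [comap_apply, map_tmul, prod_tmul, prod_tmul]; rfl) c

theorem prod_flip (μ : CStarState A) (ν : CStarState B) (c : SpatialTensor B A) :
    μ.prod ν (SpatialTensor.flip c) = ν.prod μ c :=
  ext_tmul (μ := (μ.prod ν).comap SpatialTensor.flip) (fun a b => by
    rw [comap_apply, flip_tmul, prod_tmul, prod_tmul, mul_comm]) c

theorem ext {μ ν : CStarState A} (h : ∀ a, μ a = ν a) : μ = ν := by
  cases μ; cases ν; congr; exact LinearMap.ext h

theorem prod_comap_inl (μ : CStarState A) (ν : CStarState B) :
    (μ.prod ν).comap (inl A B) = μ :=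
  ext (prod_inl μ ν)

theorem prod_comap_inr (μ : CStarState A) (ν : CStarState B) :
    (μ.prod ν).comap (inr A B) = ν :=
  ext (prod_inr μ ν)

end CStarState

/-! ### Centers of tensor products, and states multiplicative on them. -/

theorem inl_mem_starCenter {z : A} (hz : z ∈ starCenter A) :
    inl A B z ∈ starCenter (SpatialTensor A B) := by
  rw [mem_starCenter] at hz ⊢
  intro c
  induction c using dense_ofAlg.induction_on with
  | hp => exact isClosed_eq (continuous_mul_const _) (continuous_const_mul _)
  | ih t =>
    induction t with
    | zero => simp only [map_zero, zero_mul, mul_zero]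
    | add s t hs ht => simp only [map_add, add_mul, mul_add, hs, ht]
    | tmul a b =>
      change ofAlg (a ⊗ₜ b) * ofAlg (z ⊗ₜ 1) = ofAlg (z ⊗ₜ 1) * ofAlg (a ⊗ₜ b)
      rw [← map_mul, ← map_mul, Algebra.TensorProduct.tmul_mul_tmul,
        Algebra.TensorProduct.tmul_mul_tmul, hz, one_mul, mul_one]

theorem inr_mem_starCenter {z : B} (hz : z ∈ starCenter B) :
    inr A B z ∈ starCenter (SpatialTensor A B) := by
  rw [mem_starCenter] at hz ⊢
  intro c
  induction c using dense_ofAlg.induction_on with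
  | hp => exact isClosed_eq (continuous_mul_const _) (continuous_const_mul _)
  | ih t =>
    induction t with
    | zero => simp only [map_zero, zero_mul, mul_zero]
    | add s t hs ht => simp only [map_add, add_mul, mul_add, hs, ht]
    | tmul a b =>
      change ofAlg (a ⊗ₜ b) * ofAlg (1 ⊗ₜ z) = ofAlg (1 ⊗ₜ z) * ofAlg (a ⊗ₜ b)
      rw [← map_mul, ← map_mul, Algebra.TensorProduct.tmul_mul_tmul,
        Algebra.TensorProduct.tmul_mul_tmul, hz, one_mul, mul_one]

theorem tmul_eq_inl_mul_inr (a : A) (b : B) : tmul a b = inl A B a * inr A B b := by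
  change ofAlg (a ⊗ₜ b) = ofAlg (a ⊗ₜ 1) * ofAlg (1 ⊗ₜ b)
  rw [← map_mul, Algebra.TensorProduct.tmul_mul_tmul, one_mul, mul_one]

theorem centerTensor_induction {p : SpatialTensor A B → Prop} {c : SpatialTensor A B}
    (hc : c ∈ centerTensor A B) (hclosed : IsClosed {c | p c}) (hzero : p 0)
    (hadd : ∀ s t, p s → p t → p (s + t)) (hsmul : ∀ (r : ℂ) s, p s → p (r • s))
    (htmul : ∀ z ∈ starCenter A, ∀ w ∈ starCenter B, p (tmul z w)) : p c := by
  refine closure_minimal (t := {c | p c}) (fun c hc => ?_) hclosed hc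
  refine Submodule.span_induction ?_ hzero (fun s t _ _ => hadd s t) (fun r s _ => hsmul r s) hc
  rintro _ ⟨z, hz, w, hw, rfl⟩
  exact htmul z (mem_starCenter.2 (Subalgebra.mem_center_iff.1 hz)) w
    (mem_starCenter.2 (Subalgebra.mem_center_iff.1 hw))

/-- `F : A ⊗ B → W` places the factors of `A ⊗ B` along `f` and `g`, which preserve centers. -/
structure IsPlacement (F : SpatialTensor A B →⋆ₐ[ℂ] W) (f : A →⋆ₐ[ℂ] W) (g : B →⋆ₐ[ℂ] W) :
    Prop where
  tmul : ∀ a b, F (tmul a b) = f a * g b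
  left : ∀ z ∈ starCenter A, f z ∈ starCenter W
  right : ∀ z ∈ starCenter B, g z ∈ starCenter W

namespace IsPlacement

variable {F : SpatialTensor A B →⋆ₐ[ℂ] W} {f : A →⋆ₐ[ℂ] W} {g : B →⋆ₐ[ℂ] W}

theorem mem_starCenter (h : IsPlacement F f g) {c : SpatialTensor A B}
    (hc : c ∈ centerTensor A B) : F c ∈ starCenter W := by
  refine centerTensor_induction hc (isClosed_starCenter.preimage (continuous_starAlgHom F)) ?_ ?_ ?_ ?_
  · rw [map_zero]; exact zero_mem _
  · intro s t hs ht; rw [map_add]; exact add_mem hs ht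
  · intro r s hs; rw [map_smul]; exact SMulMemClass.smul_mem r hs
  · intro z hz w hw; rw [h.tmul]; exact mul_mem (h.left z hz) (h.right w hw)

/-- `Ψ` need not be a product state. On `z ⊗ w` with `z`, `w` central, however, `f z` and `g w` are
central in `W`, so `Ψ` splits their product. Linearity and continuity extend this to the closed
span. -/
theorem apply_state (h : IsPlacement F f g) {Ψ : CStarState W} (hΨ : Ψ.MulOnCenter)
    {c : SpatialTensor A B} (hc : c ∈ centerTensor A B) :
    Ψ (F c) = (Ψ.comap f).prod (Ψ.comap g) c := by
  change Ψ.comap F c = _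
  refine centerTensor_induction hc (isClosed_eq (CStarState.continuous _)
    (CStarState.continuous _)) ?_ ?_ ?_ ?_
  · simp only [map_zero]
  · intro s t hs ht; simp only [map_add, hs, ht]
  · intro r s hs; simp only [map_smul, hs]
  · intro z hz w hw
    rw [CStarState.comap_apply, h.tmul, hΨ _ (h.left z hz) _ (h.right w hw), CStarState.prod_tmul]; rfl

end IsPlacement

/-! ### Placing a pair of factors in a fourfold tensor product. -/

section FourFold

variable (A B C W)

/-- This and the next three lemmas place the factor pairs (1, 2), (3, 4), (1, 3) and (2, 4). Each
factor enters through the same composite embedding wherever it occurs, so a state of the whole has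
just four marginals, shared by all the placements. -/
theorem isPlacement_inl : IsPlacement (inl (SpatialTensor A B) (SpatialTensor C W))
    ((inl (SpatialTensor A B) (SpatialTensor C W)).comp (inl A B))
    ((inl (SpatialTensor A B) (SpatialTensor C W)).comp (inr A B)) where
  tmul a b := by rw [tmul_eq_inl_mul_inr, map_mul]; rfl
  left _ hz := inl_mem_starCenter (inl_mem_starCenter hz)
  right _ hz := inl_mem_starCenter (inr_mem_starCenter hz)

theorem isPlacement_inr : IsPlacement (inr (SpatialTensor A B) (SpatialTensor C W))
    ((inr (SpatialTensor A B) (SpatialTensor C W)).comp (inl C W))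
    ((inr (SpatialTensor A B) (SpatialTensor C W)).comp (inr C W)) where
  tmul a b := by rw [tmul_eq_inl_mul_inr, map_mul]; rfl
  left _ hz := inr_mem_starCenter (inl_mem_starCenter hz)
  right _ hz := inr_mem_starCenter (inr_mem_starCenter hz)

theorem isPlacement_map_inl : IsPlacement (map (inl A B) (inl C W))
    ((inl (SpatialTensor A B) (SpatialTensor C W)).comp (inl A B))
    ((inr (SpatialTensor A B) (SpatialTensor C W)).comp (inl C W)) where
  tmul a b := by rw [map_tmul, tmul_eq_inl_mul_inr]; rfl
  left _ hz := inl_mem_starCenter (inl_mem_starCenter hz)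
  right _ hz := inr_mem_starCenter (inl_mem_starCenter hz)

theorem isPlacement_map_inr : IsPlacement (map (inr A B) (inr C W))
    ((inl (SpatialTensor A B) (SpatialTensor C W)).comp (inr A B))
    ((inr (SpatialTensor A B) (SpatialTensor C W)).comp (inr C W)) where
  tmul a b := by rw [map_tmul, tmul_eq_inl_mul_inr]; rfl
  left _ hz := inl_mem_starCenter (inr_mem_starCenter hz)
  right _ hz := inr_mem_starCenter (inr_mem_starCenter hz)

end FourFold

end TensorFacts

/-- The final comparison of numbers for the lower bound, with `a = d(μ x, μ y)` and `b = d(μ y, μ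
y)`. -/
theorem one_le_of_sub_le_mul_add {a b : ℂ} {r : ℝ} (h : a - b ≤ r * (a + b)) (ha : 0 < a)
    (hb : b = 0) : 1 ≤ r := by
  rw [hb, sub_zero, add_zero, Complex.le_def, Complex.re_ofReal_mul] at h
  exact le_of_mul_le_mul_right ((one_mul _).trans_le h.1) (Complex.pos_iff.1 ha).1

/-! ### The scalar distance between states that a metric operator field induces. -/

section Mof

open SpatialTensor

variable {X : Type v} {A : X → Type u} [∀ x, CStarAlgebra (A x)]
  {D : OperatorField (TensorBundle A A)}

namespace IsMof

theorem state_symm (hD : IsMof A D) {x y : X} (α : CStarState (A x)) (β : CStarState (A y)) :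
    α.prod β (D (x, y)) = β.prod α (D (y, x)) := by
  rw [hD.symm x y]
  exact CStarState.prod_flip α β (D (y, x))

/-- Apply `(α ⊗ β) ⊗ γ` to the operator triangle inequality; in each term the state of the factor
that carries a unit drops out. -/
theorem state_triangle (hD : IsMof A D) {x y z : X} (α : CStarState (A x)) (β : CStarState (A y))
    (γ : CStarState (A z)) :
    α.prod γ (D (x, z)) ≤ α.prod β (D (x, y)) + β.prod γ (D (y, z)) := by
  have h := ((α.prod β).prod γ).apply_mono (hD.triangle x y z)
  rw [map_add, CStarState.prod_map, CStarState.prod_map, CStarState.prod_inl] at h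
  have e3 : γ.comap (StarAlgHom.id ℂ (A z)) = γ := rfl
  rwa [CStarState.prod_comap_inl, CStarState.prod_comap_inr, e3] at h

/-- The axioms do not demand positivity on the diagonal, so it is drawn from the triangle
inequality: `d(β, β) ≤ 2 d(β, β)` gives `0 ≤ d(β, β)`, and then `d(β, β) ≤ d(β, α) + d(α, β) = 2
d(α, β)`. The order of `ℂ` makes this include that the values are real. -/
theorem state_nonneg (hD : IsMof A D) {x y : X} (α : CStarState (A x)) (β : CStarState (A y)) :
    0 ≤ α.prod β (D (x, y)) := by
  have h1 : 0 ≤ β.prod β (D (y, y)) := nonneg_of_le_add_left (hD.state_triangle β β β)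
  have h2 := h1.trans (hD.state_triangle β α β)
  rw [hD.state_symm β α, Complex.nonneg_iff, Complex.add_re, Complex.add_im] at h2
  exact Complex.nonneg_iff.2 ⟨by linarith [h2.1], by linarith [h2.2]⟩

/-- Two triangle inequalities along the path `α`, `γ`, `δ`, `β`. -/
theorem state_quadrangle (hD : IsMof A D) {x y z w : X} (α : CStarState (A x))
    (β : CStarState (A y)) (γ : CStarState (A z)) (δ : CStarState (A w)) :
    α.prod β (D (x, y)) ≤
      α.prod γ (D (x, z)) + β.prod δ (D (y, w)) + γ.prod δ (D (z, w)) := by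
  have h1 := hD.state_triangle α γ β
  have h2 := hD.state_triangle γ δ β
  rw [hD.state_symm δ β] at h2
  calc _ ≤ _ := h1
    _ ≤ _ := add_le_add_right h2 _
    _ = _ := by ring

theorem state_quadrangle' (hD : IsMof A D) {x y z w : X} (α : CStarState (A x))
    (β : CStarState (A y)) (γ : CStarState (A z)) (δ : CStarState (A w)) :
    γ.prod δ (D (z, w)) ≤
      α.prod β (D (x, y)) + (α.prod γ (D (x, z)) + β.prod δ (D (y, w))) := by
  have h := hD.state_quadrangle γ δ α β
  rwa [hD.state_symm γ α, hD.state_symm δ β, add_comm] at h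

end IsMof

/-! ### The product field and the Lipschitz norm of a central field. -/

namespace IsCentralMof

theorem prodMof_mem_starCenter (hD : IsCentralMof A D) (p q : X × X) :
    prodMof A A D D (p, q) ∈ starCenter (SpatialTensor (SpatialTensor (A p.1) (A p.2))
      (SpatialTensor (A q.1) (A q.2))) :=
  add_mem ((isPlacement_map_inl _ _ _ _).mem_starCenter (hD.central _ _))
    ((isPlacement_map_inr _ _ _ _).mem_starCenter (hD.central _ _))

/-- The case `p.1 = q.1` is included, where positivity is no axiom; it comes from `state_nonneg` and
centrality. -/
theorem map_inl_nonneg (hD : IsCentralMof A D) (p q : X × X) :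
    0 ≤ map (inl (A p.1) (A p.2)) (inl (A q.1) (A q.2)) (D (p.1, q.1)) :=
  nonneg_of_forall_mulOnCenter
    ((isPlacement_map_inl _ _ _ _).mem_starCenter (hD.central _ _)) fun Ψ hΨ => by
      rw [(isPlacement_map_inl _ _ _ _).apply_state hΨ (hD.central _ _)]
      exact hD.state_nonneg _ _

theorem map_inr_nonneg (hD : IsCentralMof A D) (p q : X × X) :
    0 ≤ map (inr (A p.1) (A p.2)) (inr (A q.1) (A q.2)) (D (p.2, q.2)) :=
  nonneg_of_forall_mulOnCenter
    ((isPlacement_map_inr _ _ _ _).mem_starCenter (hD.central _ _)) fun Ψ hΨ => by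
      rw [(isPlacement_map_inr _ _ _ _).apply_state hΨ (hD.central _ _)]
      exact hD.state_nonneg _ _

theorem isStrictlyPositive_prodMof (hD : IsCentralMof A D) {p q : X × X} (hpq : p ≠ q) :
    IsStrictlyPositive (prodMof A A D D (p, q)) := by
  have h1 := hD.map_inl_nonneg p q
  have h2 := hD.map_inr_nonneg p q
  refine IsUnit.isStrictlyPositive ?_ (add_nonneg h1 h2)
  -- Distinct points differ in some coordinate. The summand of that coordinate is positive and
  -- invertible, and adding the other, nonnegative summand keeps the sum invertible.
  by_cases h : p.1 = q.1
  · have h' : p.2 ≠ q.2 := fun e => hpq (Prod.ext h e)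
    exact CStarAlgebra.isUnit_of_le _ (le_add_of_nonneg_left h1)
      (((hD.pos _ _ h').2.map (map (inr (A p.1) (A p.2)) (inr (A q.1) (A q.2)))).isStrictlyPositive
        h2)
  · exact CStarAlgebra.isUnit_of_le _ (le_add_of_nonneg_right h2)
      (((hD.pos _ _ h).2.map (map (inl (A p.1) (A p.2)) (inl (A q.1) (A q.2)))).isStrictlyPositive
        h1)

theorem sub_mem_starCenter (hD : IsCentralMof A D) (p q : X × X) :
    inl _ _ (D p) - inr _ _ (D q) ∈ starCenter (SpatialTensor (SpatialTensor (A p.1) (A p.2))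
      (SpatialTensor (A q.1) (A q.2))) :=
  sub_mem ((isPlacement_inl _ _ _ _).mem_starCenter (hD.central _ _))
    ((isPlacement_inr _ _ _ _).mem_starCenter (hD.central _ _))

/-- Under a state multiplicative on the center this becomes `state_quadrangle` for its four
marginals. -/
theorem sub_le_prodMof (hD : IsCentralMof A D) (p q : X × X) :
    inl _ _ (D p) - inr _ _ (D q) ≤ prodMof A A D D (p, q) := by
  rw [← sub_nonneg]
  refine nonneg_of_forall_mulOnCenter
    (sub_mem (hD.prodMof_mem_starCenter p q) (hD.sub_mem_starCenter p q)) fun Ψ hΨ => ?_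
  rw [map_sub, map_sub, sub_nonneg, sub_le_iff_le_add]
  rw [prodMof, map_add, (isPlacement_map_inl _ _ _ _).apply_state hΨ (hD.central _ _),
    (isPlacement_map_inr _ _ _ _).apply_state hΨ (hD.central _ _),
    (isPlacement_inl _ _ _ _).apply_state hΨ (hD.central _ _),
    (isPlacement_inr _ _ _ _).apply_state hΨ (hD.central _ _)]
  exact hD.state_quadrangle _ _ _ _

theorem neg_prodMof_le_sub (hD : IsCentralMof A D) (p q : X × X) :
    -prodMof A A D D (p, q) ≤ inl _ _ (D p) - inr _ _ (D q) := by
  rw [← sub_nonneg, sub_neg_eq_add]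
  refine nonneg_of_forall_mulOnCenter
    (add_mem (hD.sub_mem_starCenter p q) (hD.prodMof_mem_starCenter p q)) fun Ψ hΨ => ?_
  rw [map_add, map_sub, sub_add_eq_add_sub, sub_nonneg]
  rw [prodMof, map_add, (isPlacement_map_inl _ _ _ _).apply_state hΨ (hD.central _ _),
    (isPlacement_map_inr _ _ _ _).apply_state hΨ (hD.central _ _),
    (isPlacement_inl _ _ _ _).apply_state hΨ (hD.central _ _),
    (isPlacement_inr _ _ _ _).apply_state hΨ (hD.central _ _)]
  exact hD.state_quadrangle' _ _ _ _

/-- The element is a difference of two positive ones, `P - (P - t)` with `P = (D × D)(p, q)` and `t`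
the element itself. This avoids self-adjointness of the diagonal values of `D`. -/
theorem isSelfAdjoint_sub (hD : IsCentralMof A D) (p q : X × X) :
    IsSelfAdjoint (inl _ _ (D p) - inr _ _ (D q) :
      SpatialTensor (SpatialTensor (A p.1) (A p.2)) (SpatialTensor (A q.1) (A q.2))) := by
  have h1 : IsSelfAdjoint (prodMof A A D D (p, q)) :=
    .of_nonneg (add_nonneg (hD.map_inl_nonneg p q) (hD.map_inr_nonneg p q))
  have h2 := IsSelfAdjoint.of_nonneg (sub_nonneg.2 (hD.sub_le_prodMof p q))
  simpa only [sub_sub_cancel] using h1.sub h2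

theorem norm_lipQuotient_le_iff (hD : IsCentralMof A D) {p q : X × X} (hpq : p ≠ q) {r : ℝ}
    (hr : 0 ≤ r) : ‖lipQuotient (prodMof A A D D (p, q)) (D p) (D q)‖ ≤ r ↔
      -(r • prodMof A A D D (p, q)) ≤ inl _ _ (D p) - inr _ _ (D q) ∧
        inl _ _ (D p) - inr _ _ (D q) ≤ r • prodMof A A D D (p, q) :=
  norm_conj_le_iff (hD.isStrictlyPositive_prodMof hpq) (hD.isSelfAdjoint_sub p q) hr

theorem norm_lipQuotient_le_one (hD : IsCentralMof A D) {p q : X × X} (hpq : p ≠ q) :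
    ‖lipQuotient (prodMof A A D D (p, q)) (D p) (D q)‖ ≤ 1 := by
  rw [hD.norm_lipQuotient_le_iff hpq zero_le_one, one_smul]
  exact ⟨hD.neg_prodMof_le_sub p q, hD.sub_le_prodMof p q⟩

theorem prod_prodMof {x y z w : X} (α : CStarState (A x)) (β : CStarState (A y))
    (γ : CStarState (A z)) (δ : CStarState (A w)) :
    ((α.prod β).prod (γ.prod δ)) (prodMof A A D D ((x, y), (z, w))) =
      α.prod γ (D (x, z)) + β.prod δ (D (y, w)) := by
  rw [prodMof, map_add, CStarState.prod_map, CStarState.prod_map, CStarState.prod_comap_inl,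
    CStarState.prod_comap_inl, CStarState.prod_comap_inr, CStarState.prod_comap_inr]

theorem state_sub_le (hD : IsCentralMof A D) {x y z w : X} (hpq : (x, y) ≠ (z, w))
    (α : CStarState (A x)) (β : CStarState (A y)) (γ : CStarState (A z)) (δ : CStarState (A w)) :
    α.prod β (D (x, y)) - γ.prod δ (D (z, w)) ≤
      ‖lipQuotient (prodMof A A D D ((x, y), (z, w))) (D (x, y)) (D (z, w))‖ *
        (α.prod γ (D (x, z)) + β.prod δ (D (y, w))) := by
  -- The constant `r` is the norm of the quotient itself, so the resulting operator inequality can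
  -- be tested on a product state.
  have h1 := ((hD.norm_lipQuotient_le_iff hpq (norm_nonneg _)).1 le_rfl).2
  have h2 := ((α.prod β).prod (γ.prod δ)).apply_mono h1
  rw [map_sub, CStarState.prod_inl, CStarState.prod_inr, ← Complex.coe_smul, map_smul,
    smul_eq_mul] at h2
  exact h2.trans_eq (congrArg _ (prod_prodMof α β γ δ))

/-- At the points `(x, y)` and `(y, y)` the Lipschitz quotient of `D` has norm at least one. -/
theorem one_le_norm_lipQuotient (hD : IsCentralMof A D) {x y : X} (hxy : x ≠ y) :
    1 ≤ ‖lipQuotient (prodMof A A D D ((x, y), (y, y))) (D (x, y)) (D (y, y))‖ := by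
  obtain ⟨μ, hμ⟩ := hD.metricStates
  have hpq : (x, y) ≠ (y, y) := fun e => hxy (congrArg Prod.fst e)
  -- With these states both terms indexed by `(y, y)` equal `d(μ y, μ y) = 0`, and both remaining
  -- terms equal `d(μ x, μ y) > 0`.
  exact one_le_of_sub_le_mul_add (hD.state_sub_le hpq (μ x) (μ y) (μ y) (μ y))
    (((μ x).prod (μ y)).apply_pos (hD.pos x y hxy).1 (hD.pos x y hxy).2) (hμ y)

theorem lipNorm_prodMof [Nontrivial X] (hD : IsCentralMof A D) :
    lipNorm (TensorBundle A A) (prodMof A A D D) D = 1 := by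
  apply le_antisymm
  · refine iSup_le fun p => iSup_le fun q => iSup_le fun hpq => ?_
    rw [← ofReal_norm, ← ENNReal.ofReal_one]
    exact ENNReal.ofReal_le_ofReal (hD.norm_lipQuotient_le_one hpq)
  · obtain ⟨x, y, hxy⟩ := exists_pair_ne X
    refine le_iSup_of_le (x, y) (le_iSup_of_le (y, y)
      (le_iSup_of_le (fun e => hxy (congrArg Prod.fst e)) ?_))
    rw [← ofReal_norm, ← ENNReal.ofReal_one]
    exact ENNReal.ofReal_le_ofReal (hD.one_le_norm_lipQuotient hxy)

theorem fieldCommutes_prodMof (hD : IsCentralMof A D) :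
    FieldCommutes (TensorBundle A A) (prodMof A A D D) D := fun p q =>
  (mem_starCenter.1 (hD.prodMof_mem_starCenter p q) _).symm

end IsCentralMof

end Mof

theorem mainTheorem11 {X : Type v} [Nontrivial X] (A : X → Type u) [∀ x, CStarAlgebra (A x)]
    (D : OperatorField (TensorBundle A A)) (hD : IsCentralMof A D) :
    (∀ p q : X × X, p ≠ q → 0 ≤ prodMof A A D D (p, q) ∧ IsUnit (prodMof A A D D (p, q))) ∧
      IsLipschitz (TensorBundle A A) (prodMof A A D D) D ∧
      lipNorm (TensorBundle A A) (prodMof A A D D) D = 1 ∧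
      (supNorm (TensorBundle A A) D < ⊤ → D ∈ lipAlgebra (TensorBundle A A) (prodMof A A D D)) := by
  have hlip : IsLipschitz (TensorBundle A A) (prodMof A A D D) D :=
    hD.lipNorm_prodMof.trans_lt ENNReal.one_lt_top
  exact ⟨fun p q hpq => ⟨(hD.isStrictlyPositive_prodMof hpq).nonneg,
    (hD.isStrictlyPositive_prodMof hpq).isUnit⟩, hlip, hD.lipNorm_prodMof,
    fun hb => ⟨hb, hlip, hD.fieldCommutes_prodMof⟩⟩
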